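/- Let $\beta^n$ denote the causal polynomial B-spline of degree $n$ on $[0,n+1]$ with integer knots, $\beta^n(t)=\frac1{n!}\sum_{k=0}^{n+1}(-1)^k\binom{n+1}{k}(t-k)_+^n$. Consider pairs $(\varphi_1,\varphi_2)$ of functions in $L_2(\mathbb R)$ (real- or complex-valued). Such a pair reproduces $f$ with sequences satisfying the moment condition if there are scalar sequences $a,b$ on $\mathbb Z$ with $\sum_{k\in\mathbb Z}|k|^3(|a_k|+|b_k|)<\infty$ and $f=\sum_{k\in\mathbb Z}\big(a_k\varphi_1(\cdot-k)+b_k\varphi_2(\cdot-k)\big)$ in $L_2(\mathbb R)$. The support $\operatorname{Supp}\varphi$ is the complement of the largest open set on which $\varphi=0$ almost everywhere, and $|\operatorname{Supp}\varphi|\in[0,\infty]$ is its size, which may be read either as the Lebesgue measure of $\operatorname{Supp}\varphi$ or as the length of the smallest interval containing it (the statement holds in both readings). Let $\phi_1(t)=(2|t|+1)(|t|-1)^2$ and $\phi_2(t)=t(|t|-1)^2$ for $|t|\le1$, and $\phi_1(t)=\phi_2(t)=0$ for $|t|>1$ (the cubic Hermite splines). Then $\phi_1,\phi_2\in L_2(\mathbb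 R)$, and their integer shifts form a Riesz basis: there are constants $0<A\le B<\infty$ such that for all $c_1,c_2\in\ell_2(\mathbb Z)$ the series $\sum_{i=1}^2\sum_{k\in\mathbb Z}c_i[k]\phi_i(\cdot-k)$ converges in $L_2(\mathbb R)$, with $$A\sum_{i=1}^2\sum_{k\in\mathbb Z}|c_i[k]|^2\le\Big\|\sum_{i=1}^2\sum_{k\in\mathbb Z}c_i[k]\phi_i(\cdot-k)\Big\|_{L_2}^2\le B\sum_{i=1}^2\sum_{k\in\mathbb Z}|c_i[k]|^2 .$$ The pair $(\phi_1,\phi_2)$ reproduces both $\beta^2$ and $\beta^3$ with sequences satisfying the moment condition, and $|\operatorname{Supp}\phi_1|+|\operatorname{Supp}\phi_2|=4$. Moreover, every pair $(\varphi_1,\varphi_2)$ of functions in $L_2(\mathbb R)$ that reproduces both $\beta^2$ and $\beta^3$ with sequences satisfying the moment condition has $$|\operatorname{Supp}\varphi_1|+|\operatorname{Supp}\varphi_2|\ \ge\ |\operatorname{Supp}\phi_1|+|\operatorname{Supp}\phi_2|=4 .$$ -/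

import Mathlib

open MeasureTheory Filter Topology

noncomputable section

/-- The truncated power `x_+ ^ n` (with `x_+ ^ 0` the indicator function of `[0, ∞)`). -/
def truncPow (n : ℕ) (x : ℝ) : ℝ := if 0 ≤ x then x ^ n else 0

/-- The (causal) polynomial B-spline `β^n` of degree `n`, i.e. of order `n + 1`, with knots at the
integers `0, …, n + 1`: the `(n + 1)`-st backward difference of `x_+ ^ n / n!`. Its Fourier transform
is `((1 - e^{-jω}) / (jω)) ^ (n + 1)`, and its support is `[0, n + 1]`. -/
def bspline (n : ℕ) (t : ℝ) : ℝ :=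
  (∑ k ∈ Finset.range (n + 2), (-1 : ℝ) ^ k * ((n + 1).choose k : ℝ) * truncPow n (t - k))
    / (n.factorial : ℝ)

/-- First cubic Hermite spline, `(2|t| + 1)(|t| - 1)²` on `[-1, 1]` and `0` elsewhere. -/
def hermite₁ (t : ℝ) : ℝ :=
  if |t| ≤ 1 then (2 * |t| + 1) * (|t| - 1) ^ 2 else 0

/-- Second cubic Hermite spline, `t (|t| - 1)²` on `[-1, 1]` and `0` elsewhere. -/
def hermite₂ (t : ℝ) : ℝ :=
  if |t| ≤ 1 then t * (|t| - 1) ^ 2 else 0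

section

variable {𝕜 : Type*} [RCLike 𝕜]

/-- A real function regarded as a function with values in `𝕜` (which is `ℝ` or `ℂ`). -/
def toScalar (𝕜 : Type*) [RCLike 𝕜] (f : ℝ → ℝ) : ℝ → 𝕜 := fun t => ((f t : ℝ) : 𝕜)

/-- The pair of cubic Hermite splines. -/
def hermitePair (𝕜 : Type*) [RCLike 𝕜] : Fin 2 → ℝ → 𝕜 :=
  ![toScalar 𝕜 hermite₁, toScalar 𝕜 hermite₂]

/-- `f = ∑ i, ∑ k, c_i[k] φ_i(· - k)`, with unconditional convergence in `L²(ℝ)`. -/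
def HasShiftExpansion {N : ℕ} (φ : Fin N → ℝ → 𝕜) (c : Fin N → ℤ → 𝕜) (f : ℝ → 𝕜) : Prop :=
  Tendsto
    (fun s : Finset (Fin N × ℤ) =>
      eLpNorm (fun t : ℝ => f t - ∑ p ∈ s, c p.1 p.2 * φ p.1 (t - (p.2 : ℝ))) 2 volume)
    atTop (𝓝 0)

/-- The integer shifts of `φ_1, …, φ_N` form a Riesz basis (of the space they generate):
for all square-summable coefficients the expansion converges in `L²(ℝ)` and its squared norm is
comparable to the squared `ℓ²` norm of the coefficients. -/
def IsRieszFamily {N : ℕ} (φ : Fin N → ℝ → 𝕜) : Prop :=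
  ∃ A B : ℝ, 0 < A ∧ A ≤ B ∧
    ∀ c : Fin N → ℤ → 𝕜, (∀ i, Summable fun k : ℤ => ‖c i k‖ ^ 2) →
      ∃ f : ℝ → 𝕜, MemLp f 2 volume ∧ HasShiftExpansion φ c f ∧
        A * ∑ i, ∑' k : ℤ, ‖c i k‖ ^ 2 ≤ (eLpNorm f 2 volume).toReal ^ 2 ∧
        (eLpNorm f 2 volume).toReal ^ 2 ≤ B * ∑ i, ∑' k : ℤ, ‖c i k‖ ^ 2

/-- The moment condition on reproduction sequences: `∑ k, |k|³ |c_i[k]| < ∞` for every `i`. -/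
def MomentCondition {N : ℕ} (c : Fin N → ℤ → 𝕜) : Prop :=
  ∀ i, Summable fun k : ℤ => |(k : ℝ)| ^ 3 * ‖c i k‖

/-- `φ` reproduces `f` with reproduction sequences that satisfy the moment condition. -/
def Reproduces {N : ℕ} (φ : Fin N → ℝ → 𝕜) (f : ℝ → 𝕜) : Prop :=
  ∃ c : Fin N → ℤ → 𝕜, MomentCondition c ∧ HasShiftExpansion φ c f

/-- The support of (the almost everywhere class of) `f`: the complement of the largest open set on
which `f` vanishes almost everywhere. -/
def essSupport (f : ℝ → 𝕜) : Set ℝ :=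
  {x | ∀ U ∈ 𝓝 x, ¬ f =ᵐ[volume.restrict U] 0}

/-- Sum of the Lebesgue measures of the supports. -/
def totalSupportMeasure {N : ℕ} (φ : Fin N → ℝ → 𝕜) : ENNReal :=
  ∑ i, volume (essSupport (φ i))

/-- Sum of the lengths of the smallest intervals containing the supports (infinite as soon as
some support is not compact). -/
def totalSupportLength {N : ℕ} (φ : Fin N → ℝ → 𝕜) : ENNReal :=
  ∑ i, Metric.ediam (essSupport (φ i))

end

end

/-! ### Essential support of a function on the line -/

section Support

variable {𝕜 : Type*} [RCLike 𝕜]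

/-! Lower bound: the total support measure is the integral over `[0, 1)` of the number of shifted
supports containing `t`. If it is below 4, fewer than 4 shifts are active on a non-null set of `t`,
and infinitely many of these `t` share one finite active set `F`. There the four numbers `β³(t + m)`
are fixed linear combinations of the `|F| < 4` values `φ_i(t - k)`, so one nontrivial relation among
them holds at infinitely many `t`. The pieces of `β³` are linearly independent cubics, a
contradiction (`HasShiftExpansion.le_totalSupportMeasure`, `bspline_three_shifts_independent`).
Length dominates measure, so both readings follow.

Hermite pair: a `C¹` piecewise cubic with integer knots is determined by its knot values and slopes,
which gives the coefficients of `β²` and `β³`. The Riesz bounds are local: on each unit interval the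
squared norm is a positive definite form in the four end-point data, and the intervals are summed.
-/

theorem isClosed_essSupport (f : ℝ → 𝕜) : IsClosed (essSupport f) := by
  rw [← isOpen_compl_iff, isOpen_iff_mem_nhds]
  intro x hx
  simp only [essSupport, Set.mem_compl_iff, Set.mem_ofPred_eq, not_forall, not_not] at hx
  obtain ⟨U, hU, hf⟩ := hx
  filter_upwards [eventually_mem_nhds_iff.2 hU] with y hy hy'
  exact hy' U hy hf

theorem ae_eq_zero_of_notMem_essSupport (f : ℝ → 𝕜) :
    ∀ᵐ x, x ∉ essSupport f → f x = 0 := by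
  rw [ae_iff]
  -- Second countability of `ℝ` lets local nullity suffice.
  refine measure_null_of_locally_null _ fun x hx => ?_
  simp only [Set.mem_ofPred_eq, Classical.not_imp] at hx
  obtain ⟨hx, -⟩ := hx
  simp only [essSupport, Set.mem_ofPred_eq, not_forall, not_not] at hx
  obtain ⟨U, hU, hf⟩ := hx
  refine ⟨{x | ¬ f x = 0} ∩ U, ?_, ?_⟩
  · rw [mem_nhdsWithin_iff_eventually]
    filter_upwards [hU] with y hy hy'
    simp only [Classical.not_imp] at hy'
    exact ⟨hy'.2, hy⟩
  · exact le_antisymm ((Measure.le_restrict_apply _ _).trans (ae_iff.1 hf).le) bot_le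

theorem essSupport_subset_of_isClosed {f : ℝ → 𝕜} {K : Set ℝ} (hK : IsClosed K)
    (hf : ∀ x ∉ K, f x = 0) : essSupport f ⊆ K := by
  intro x hx
  by_contra hxK
  refine hx Kᶜ (hK.isOpen_compl.mem_nhds hxK) ?_
  exact (ae_restrict_mem hK.measurableSet.compl).mono fun y hy => hf y hy

theorem totalSupportMeasure_le_totalSupportLength {N : ℕ} (φ : Fin N → ℝ → 𝕜) :
    totalSupportMeasure φ ≤ totalSupportLength φ :=
  Finset.sum_le_sum fun _ _ => Real.volume_le_diam _

end Support

/-! ### Lower bound on the total support by counting active shifts -/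

section LowerBound

variable {𝕜 : Type*} [RCLike 𝕜] {N : ℕ}

theorem ae_add_intCast {P : ℝ → Prop} (h : ∀ᵐ t, P t) : ∀ᵐ t : ℝ, ∀ m : ℤ, P (t + m) :=
  ae_all_iff.2 fun m =>
    (measurePreserving_add_right volume (m : ℝ)).quasiMeasurePreserving.ae h

/-- Almost everywhere, an `L²` expansion holds pointwise wherever it has finitely many terms. -/
theorem HasShiftExpansion.ae_eq_sum {φ : Fin N → ℝ → 𝕜} {c : Fin N → ℤ → 𝕜} {f : ℝ → 𝕜}
    (h : HasShiftExpansion φ c f) (hφ : ∀ i, AEStronglyMeasurable (φ i) volume)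
    (hf : AEStronglyMeasurable f volume) :
    ∀ᵐ t : ℝ, ∀ F : Finset (Fin N × ℤ), (∀ p ∉ F, φ p.1 (t - (p.2 : ℝ)) = 0) →
      f t = ∑ p ∈ F, c p.1 p.2 * φ p.1 (t - (p.2 : ℝ)) := by
  have hmeas : ∀ s : Finset (Fin N × ℤ), AEStronglyMeasurable
      (fun t : ℝ => ∑ p ∈ s, c p.1 p.2 * φ p.1 (t - (p.2 : ℝ))) volume := by
    intro s
    refine Finset.aestronglyMeasurable_fun_sum _ fun p _ => ?_
    exact ((hφ p.1).comp_quasiMeasurePreserving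
      (measurePreserving_sub_right volume (p.2 : ℝ)).quasiMeasurePreserving).const_mul _
  have hm : TendstoInMeasure volume
      (fun (s : Finset (Fin N × ℤ)) (t : ℝ) => ∑ p ∈ s, c p.1 p.2 * φ p.1 (t - (p.2 : ℝ)))
      atTop f := by
    refine tendstoInMeasure_of_tendsto_eLpNorm (p := 2) (by norm_num) hmeas hf ?_
    refine h.congr fun s => ?_
    rw [← eLpNorm_neg]
    congr 1
    ext t
    simp
  -- One almost everywhere convergent subsequence serves every `F`: its partial sums become constant
  -- once the index sets contain `F`.
  obtain ⟨ns, hns, hlim⟩ := hm.exists_seq_tendsto_ae'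
  filter_upwards [hlim] with t ht F hF
  refine tendsto_nhds_unique ht (tendsto_const_nhds.congr' ?_)
  filter_upwards [hns.eventually (eventually_ge_atTop F)] with n hn
  exact Finset.sum_subset hn fun p _ hp => by rw [hF p hp, mul_zero]

/-- Periodization: the number of integer translates of the sets `S i` that contain `t` integrates
over `[0, 1)` to the sum of their measures. -/
theorem lintegral_tsum_indicator_sub (S : Fin N → Set ℝ) (hS : ∀ i, MeasurableSet (S i)) :
    ∫⁻ t in Set.Ico (0 : ℝ) 1, ∑' p : Fin N × ℤ, (S p.1).indicator 1 (t - (p.2 : ℝ)) =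
      ∑ i, volume (S i) := by
  have hmeas : ∀ p : Fin N × ℤ,
      Measurable fun t : ℝ => (S p.1).indicator (1 : ℝ → ENNReal) (t - (p.2 : ℝ)) := fun p =>
    (measurable_one.indicator (hS p.1)).comp (measurable_id.sub_const _)
  rw [lintegral_tsum fun p => (hmeas p).aemeasurable,
    ENNReal.summable.tsum_prod' fun _ => ENNReal.summable, tsum_fintype]
  refine Finset.sum_congr rfl fun i _ => ?_
  have h1 : ∀ k : ℤ, ∫⁻ t in Set.Ico (0 : ℝ) 1, (S i).indicator 1 (t - (k : ℝ)) =
      volume (S i ∩ Set.Ico ((-k : ℤ) : ℝ) ((-k : ℤ) + 1)) := by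
    intro k
    have h2 : (fun t : ℝ => (S i).indicator (1 : ℝ → ENNReal) (t - (k : ℝ))) =
        ((fun t : ℝ => t - (k : ℝ)) ⁻¹' S i).indicator 1 := by
      rfl
    have h3 : (fun t : ℝ => t - (k : ℝ)) ⁻¹' S i ∩ Set.Ico (0 : ℝ) 1 =
        (fun t : ℝ => t - (k : ℝ)) ⁻¹' (S i ∩ Set.Ico ((-k : ℤ) : ℝ) ((-k : ℤ) + 1)) := by
      ext t
      simp only [Set.mem_inter_iff, Set.mem_preimage, Set.mem_Ico, Int.cast_neg]
      refine and_congr_right fun _ => ⟨fun h => ⟨?_, ?_⟩, fun h => ⟨?_, ?_⟩⟩ <;> linarith [h.1, h.2]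
    have h4 : MeasurableSet ((fun t : ℝ => t - (k : ℝ)) ⁻¹' S i) :=
      measurable_id.sub_const (k : ℝ) (hS i)
    rw [h2, lintegral_indicator_one h4, Measure.restrict_apply h4, h3]
    exact (measurePreserving_sub_right volume (k : ℝ)).measure_preimage
      ((hS i).inter measurableSet_Ico).nullMeasurableSet
  simp only [h1]
  refine ((Equiv.neg ℤ).tsum_eq fun k : ℤ => volume (S i ∩ Set.Ico (k : ℝ) (k + 1))).trans ?_
  rw [← measure_iUnion _ fun k => (hS i).inter measurableSet_Ico, ← Set.inter_iUnion,
    iUnion_Ico_intCast, Set.inter_univ]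
  exact fun a b hab => (Set.pairwise_disjoint_Ico_intCast ℝ hab).mono
    Set.inter_subset_right Set.inter_subset_right

/-- If `n` consecutive shifts of `f` are linearly independent on every infinite subset of `[0, 1)`,
then functions whose shifts generate `f` have total support at least `n`. -/
theorem HasShiftExpansion.le_totalSupportMeasure {φ : Fin N → ℝ → 𝕜} {c : Fin N → ℤ → 𝕜}
    {f : ℝ → 𝕜} {n : ℕ} (h : HasShiftExpansion φ c f)
    (hφ : ∀ i, AEStronglyMeasurable (φ i) volume) (hf : AEStronglyMeasurable f volume)
    (hind : ∀ g : Fin n → 𝕜,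
      {t ∈ Set.Ico (0 : ℝ) 1 | ∑ m, g m * f (t + (m : ℕ)) = 0}.Infinite → g = 0) :
    (n : ENNReal) ≤ totalSupportMeasure φ := by
  by_contra! hlt
  set S : Fin N → Set ℝ := fun i => essSupport (φ i) with hSdef
  have hS : ∀ i, MeasurableSet (S i) := fun i => (isClosed_essSupport _).measurableSet
  set M : ℝ → ENNReal := fun t => ∑' p : Fin N × ℤ, (S p.1).indicator 1 (t - (p.2 : ℝ)) with hM
  let P : ℝ → Set (Fin N × ℤ) := fun t => {p | t - (p.2 : ℝ) ∈ S p.1}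
  have hMP : ∀ t, M t = (P t).encard := by
    intro t
    rw [← ENNReal.tsum_set_one, tsum_subtype (P t) fun _ => (1 : ENNReal)]
    rfl
  have hzero : ∀ᵐ t : ℝ, ∀ p : Fin N × ℤ, p ∉ P t → φ p.1 (t - (p.2 : ℝ)) = 0 := by
    refine ae_all_iff.2 fun p => ?_
    exact (measurePreserving_sub_right volume (p.2 : ℝ)).quasiMeasurePreserving.ae
      (ae_eq_zero_of_notMem_essSupport (φ p.1))
  have hsum := ae_add_intCast (h.ae_eq_sum hφ hf)
  let G : Set ℝ := {t | (∀ p : Fin N × ℤ, p ∉ P t → φ p.1 (t - (p.2 : ℝ)) = 0) ∧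
    ∀ m : ℤ, ∀ F : Finset (Fin N × ℤ), (∀ p ∉ F, φ p.1 (t + m - (p.2 : ℝ)) = 0) →
      f (t + m) = ∑ p ∈ F, c p.1 p.2 * φ p.1 (t + m - (p.2 : ℝ))}
  have hG : ∀ᵐ t, t ∈ G := by
    filter_upwards [hzero, hsum] with t h1 h2 using ⟨h1, h2⟩
  let E : Set ℝ := {t | t ∈ Set.Ico (0 : ℝ) 1 ∧ M t < n ∧ t ∈ G}
  -- A countable `E` would be null, so the count would be at least `n` almost everywhere, and so
  -- would its integral.
  have hE : ¬ E.Countable := by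
    intro hc
    have h0 : ∀ᵐ t, t ∉ E := by
      rw [ae_iff]; simpa using hc.measure_zero volume
    have h1 : ∀ᵐ t ∂volume.restrict (Set.Ico (0 : ℝ) 1), (n : ENNReal) ≤ M t := by
      rw [ae_restrict_iff' measurableSet_Ico]
      filter_upwards [h0, hG] with t ht htG htI
      by_contra! hlt
      exact ht ⟨htI, hlt, htG⟩
    have h2 := lintegral_mono_ae h1
    rw [lintegral_const, lintegral_tsum_indicator_sub S hS] at h2
    simp only [Measure.restrict_apply MeasurableSet.univ, Set.univ_inter, Real.volume_Ico, sub_zero,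
      ENNReal.ofReal_one, mul_one] at h2
    exact absurd hlt (not_lt.2 h2)
  -- Pigeonhole: there are only countably many finite index sets.
  have hfin : ∃ F : Finset (Fin N × ℤ), {t ∈ E | P t = F}.Infinite := by
    by_contra! hcon
    refine hE ((Set.countable_iUnion fun F : Finset (Fin N × ℤ) =>
      (hcon F).countable).mono fun t ht => ?_)
    have hPfin : (P t).Finite := by
      rw [← Set.encard_lt_top_iff]
      have := ht.2.1.trans (ENNReal.natCast_lt_top n)
      rw [hMP] at this
      by_contra htop
      rw [not_lt, top_le_iff] at htop
      simp [htop] at this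
    exact Set.mem_iUnion.2 ⟨hPfin.toFinset, ht, by simp⟩
  obtain ⟨F, hF⟩ := hfin
  have hcard : F.card < n := by
    obtain ⟨t, ht, htF⟩ := hF.nonempty
    have := ht.2.1
    rw [hMP, htF, Set.encard_coe_eq_coe_finsetCard] at this
    exact_mod_cast this
  -- Coefficient vectors of the `n` shifts on the common active set: `n` vectors in a space of
  -- dimension `|F| < n`.
  let v : Fin n → F → 𝕜 := fun m p => c p.1.1 (p.1.2 + (m : ℕ))
  have hdep : ¬ LinearIndependent 𝕜 v := by
    intro hv
    have := hv.fintype_card_le_finrank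
    simp only [Fintype.card_fin, Module.finrank_fintype_fun_eq_card, Fintype.card_coe] at this
    omega
  obtain ⟨g, hg, m₀, hm₀⟩ := Fintype.not_linearIndependent_iff.1 hdep
  refine hm₀ (congrFun (hind g (hF.mono ?_)) m₀)
  rintro t ⟨⟨htI, -, htz, hts⟩, htF⟩
  refine ⟨htI, ?_⟩
  -- The active set at `t + m` is `F` translated by `m`, so all these expansions use the same values
  -- `φ_i(t - k)`.
  have key : ∀ m : ℕ, f (t + m) =
      ∑ p ∈ F, c p.1 (p.2 + m) * φ p.1 (t - (p.2 : ℝ)) := by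
    intro m
    let e : Fin N × ℤ ≃ Fin N × ℤ := (Equiv.refl _).prodCongr (Equiv.addRight (m : ℤ))
    have h1 := hts m (F.map e.toEmbedding) ?_
    · rw [Finset.sum_map] at h1
      simpa [e] using h1
    · intro p hp
      obtain ⟨q, rfl⟩ := e.surjective p
      have hq : q ∉ P t := by
        rw [htF]
        simpa using hp
      simpa [e] using htz q hq
  simp only [key, Finset.mul_sum]
  rw [Finset.sum_comm]
  refine Finset.sum_eq_zero fun p hp => ?_
  have := congrFun hg ⟨p, hp⟩
  simp only [v, Finset.sum_apply, Pi.smul_apply, smul_eq_mul, Pi.zero_apply] at this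
  rw [← zero_mul (φ p.1 (t - (p.2 : ℝ))), ← this, Finset.sum_mul]
  exact Finset.sum_congr rfl fun m _ => by ring

end LowerBound

/-! ### Independence of the shifts of the cubic B-spline -/

section BSpline

theorem measurable_bspline (n : ℕ) : Measurable (bspline n) := by
  unfold bspline truncPow
  refine (Finset.measurable_fun_sum _ fun k _ => Measurable.const_mul ?_ _).div_const _
  exact Measurable.ite (measurableSet_le measurable_const (measurable_id.sub_const _))
    ((measurable_id.sub_const _).pow_const _) measurable_const

theorem bspline_three_of_mem_Ico {t : ℝ} (ht : t ∈ Set.Ico (0 : ℝ) 1) :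
    bspline 3 t = t ^ 3 / 6 ∧ bspline 3 (t + 1) = (-3 * t ^ 3 + 3 * t ^ 2 + 3 * t + 1) / 6 ∧
      bspline 3 (t + 2) = (3 * t ^ 3 - 6 * t ^ 2 + 4) / 6 ∧
      bspline 3 (t + 3) = (1 - t) ^ 3 / 6 := by
  obtain ⟨h0, h1⟩ := ht
  simp only [bspline, truncPow, Finset.sum_range_succ, Finset.sum_range_zero]
  norm_num [Nat.choose, Nat.factorial]
  refine ⟨?_, ?_, ?_, ?_⟩
  all_goals
    repeat first | rw [if_pos (by linarith)] | rw [if_neg (by linarith)]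
    ring

theorem sum_mul_pow_eq_zero_of_infinite {𝕜 : Type*} [RCLike 𝕜] {d : ℕ} {a : Fin d → 𝕜}
    {s : Set ℝ} (hs : s.Infinite) (h : ∀ t ∈ s, ∑ j, a j * (t : 𝕜) ^ (j : ℕ) = 0) : a = 0 := by
  let p : Polynomial 𝕜 := ∑ j : Fin d, Polynomial.monomial (j : ℕ) (a j)
  have hp : p = 0 := by
    refine Polynomial.eq_zero_of_infinite_isRoot p
      ((hs.image (RCLike.ofReal_injective (K := 𝕜)).injOn).mono ?_)
    rintro _ ⟨t, ht, rfl⟩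
    simp [p, Polynomial.IsRoot, Polynomial.eval_finsetSum, h t ht]
  ext j
  have := congrArg (fun q : Polynomial 𝕜 => q.coeff (j : ℕ)) hp
  simpa [p, Polynomial.finsetSum_coeff, Polynomial.coeff_monomial, Fin.val_inj] using this

theorem bspline_three_shifts_independent {𝕜 : Type*} [RCLike 𝕜] (g : Fin 4 → 𝕜)
    (h : {t ∈ Set.Ico (0 : ℝ) 1 |
      ∑ m, g m * toScalar 𝕜 (bspline 3) (t + (m : ℕ)) = 0}.Infinite) : g = 0 := by
  -- The vector lists the coefficients of `1, t, t², t³` in six times the relation.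
  have key := sum_mul_pow_eq_zero_of_infinite (𝕜 := 𝕜) (d := 4)
    (a := ![g 1 + 4 * g 2 + g 3, 3 * g 1 - 3 * g 3, 3 * g 1 - 6 * g 2 + 3 * g 3,
      g 0 - 3 * g 1 + 3 * g 2 - g 3]) h ?_
  · have h0 := congrFun key 0
    have h1 := congrFun key 1
    have h2 := congrFun key 2
    have h3 := congrFun key 3
    simp at h0 h1 h2 h3
    have e1 : g 1 = 0 := by linear_combination h0 / 6 + h1 / 6 + h2 / 9
    have e3 : g 3 = 0 := by linear_combination e1 - h1 / 3
    have e2 : g 2 = 0 := by linear_combination (h0 - e1 - e3) / 4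
    have e0 : g 0 = 0 := by linear_combination h3 + 3 * e1 - 3 * e2 + e3
    ext m
    fin_cases m <;> assumption
  · rintro t ⟨ht, hsum⟩
    obtain ⟨b0, b1, b2, b3⟩ := bspline_three_of_mem_Ico ht
    have v3 : ((3 : Fin 4) : ℕ) = 3 := rfl
    simp only [Fin.sum_univ_four, toScalar, Fin.val_zero, Fin.val_one, Fin.val_two,
      v3, Nat.cast_zero, Nat.cast_one, Nat.cast_ofNat, add_zero, b0, b1, b2, b3] at hsum
    push_cast at hsum
    simp [Fin.sum_univ_four]
    linear_combination 6 * hsum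

end BSpline

/-! ### Hermite expansions of the B-splines -/

section Reproduction

variable {𝕜 : Type*} [RCLike 𝕜] {N : ℕ}

theorem Reproduces.of_eq_sum {φ : Fin N → ℝ → 𝕜} {f : ℝ → 𝕜} (c : Fin N → ℤ → 𝕜)
    (K : Finset ℤ) (hc : ∀ i, ∀ k ∉ K, c i k = 0)
    (hf : ∀ t, f t = ∑ i, ∑ k ∈ K, c i k * φ i (t - (k : ℝ))) : Reproduces φ f := by
  refine ⟨c, fun i => summable_of_ne_finset_zero (s := K) fun k hk => by simp [hc i k hk], ?_⟩
  refine tendsto_const_nhds.congr' ?_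
  filter_upwards [eventually_ge_atTop (Finset.univ ×ˢ K)] with s hs
  have : (fun t : ℝ => f t - ∑ p ∈ s, c p.1 p.2 * φ p.1 (t - (p.2 : ℝ))) = 0 := by
    ext t
    rw [hf, ← Finset.sum_product', Finset.sum_subset hs, Pi.zero_apply, sub_self]
    intro p _ hp
    rw [hc p.1 p.2 (by simpa using hp), zero_mul]
  rw [this, eLpNorm_zero]

theorem hermite₁_of_nonneg {t : ℝ} (h0 : 0 ≤ t) (h1 : t ≤ 1) :
    hermite₁ t = (2 * t + 1) * (t - 1) ^ 2 := by
  simp [hermite₁, abs_of_nonneg h0, h1]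

theorem hermite₂_of_nonneg {t : ℝ} (h0 : 0 ≤ t) (h1 : t ≤ 1) :
    hermite₂ t = t * (t - 1) ^ 2 := by
  simp [hermite₂, abs_of_nonneg h0, h1]

theorem hermite₁_of_nonpos {t : ℝ} (h0 : t ≤ 0) (h1 : -1 ≤ t) :
    hermite₁ t = (1 - 2 * t) * (t + 1) ^ 2 := by
  rw [hermite₁, abs_of_nonpos h0, if_pos (by linarith)]
  ring

theorem hermite₂_of_nonpos {t : ℝ} (h0 : t ≤ 0) (h1 : -1 ≤ t) :
    hermite₂ t = t * (t + 1) ^ 2 := by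
  rw [hermite₂, abs_of_nonpos h0, if_pos (by linarith)]
  ring

theorem hermite₁_of_one_le_abs {t : ℝ} (h : 1 ≤ |t|) : hermite₁ t = 0 := by
  rcases h.eq_or_lt with h | h
  · simp [hermite₁, ← h]
  · rw [hermite₁, if_neg h.not_ge]

theorem hermite₂_of_one_le_abs {t : ℝ} (h : 1 ≤ |t|) : hermite₂ t = 0 := by
  rcases h.eq_or_lt with h | h
  · simp [hermite₂, ← h]
  · rw [hermite₂, if_neg h.not_ge]

/-- Hermite interpolation: `β²` has values `1/2, 1/2` and slopes `1, -1` at the knots `1, 2`. -/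
theorem bspline_two_eq_hermite (t : ℝ) :
    bspline 2 t = 1 / 2 * hermite₁ (t - 1) + 1 / 2 * hermite₁ (t - 2)
      + (hermite₂ (t - 1) - hermite₂ (t - 2)) := by
  have hcases : t < 0 ∨ (0 ≤ t ∧ t < 1) ∨ (1 ≤ t ∧ t < 2) ∨ (2 ≤ t ∧ t < 3) ∨ 3 ≤ t := by
    grind
  simp only [bspline, truncPow, Finset.sum_range_succ, Finset.sum_range_zero]
  norm_num [Nat.choose, Nat.factorial]
  rcases hcases with h | h | h | h | h
  all_goals
    repeat first
      | rw [if_pos (by linarith)]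
      | rw [if_neg (by linarith)]
      | rw [hermite₁_of_nonneg (by linarith) (by linarith)]
      | rw [hermite₁_of_nonpos (by linarith) (by linarith)]
      | rw [hermite₂_of_nonneg (by linarith) (by linarith)]
      | rw [hermite₂_of_nonpos (by linarith) (by linarith)]
      | rw [hermite₁_of_one_le_abs (le_abs.2 (by first | left; linarith | right; linarith))]
      | rw [hermite₂_of_one_le_abs (le_abs.2 (by first | left; linarith | right; linarith))]
    ring

/-- At the knots `1, 2, 3` the values are `1/6, 2/3, 1/6` and the slopes `1/2, 0, -1/2`. -/
theorem bspline_three_eq_hermite (t : ℝ) :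
    bspline 3 t = 1 / 6 * hermite₁ (t - 1) + 2 / 3 * hermite₁ (t - 2) + 1 / 6 * hermite₁ (t - 3)
      + 1 / 2 * (hermite₂ (t - 1) - hermite₂ (t - 3)) := by
  have hcases : t < 0 ∨ (0 ≤ t ∧ t < 1) ∨ (1 ≤ t ∧ t < 2) ∨ (2 ≤ t ∧ t < 3) ∨
      (3 ≤ t ∧ t < 4) ∨ 4 ≤ t := by
    grind
  simp only [bspline, truncPow, Finset.sum_range_succ, Finset.sum_range_zero]
  norm_num [Nat.choose, Nat.factorial]
  rcases hcases with h | h | h | h | h | h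
  all_goals
    repeat first
      | rw [if_pos (by linarith)]
      | rw [if_neg (by linarith)]
      | rw [hermite₁_of_nonneg (by linarith) (by linarith)]
      | rw [hermite₁_of_nonpos (by linarith) (by linarith)]
      | rw [hermite₂_of_nonneg (by linarith) (by linarith)]
      | rw [hermite₂_of_nonpos (by linarith) (by linarith)]
      | rw [hermite₁_of_one_le_abs (le_abs.2 (by first | left; linarith | right; linarith))]
      | rw [hermite₂_of_one_le_abs (le_abs.2 (by first | left; linarith | right; linarith))]
    ring

theorem reproduces_bspline_two : Reproduces (hermitePair 𝕜) (toScalar 𝕜 (bspline 2)) := by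
  refine Reproduces.of_eq_sum
    ![fun k => if k = 1 then 1 / 2 else if k = 2 then 1 / 2 else 0,
      fun k => if k = 1 then 1 else if k = 2 then -1 else 0] {1, 2} ?_ ?_
  · intro i k hk
    simp only [Finset.mem_insert, Finset.mem_singleton, not_or] at hk
    fin_cases i <;> simp [hk]
  · intro t
    simp only [toScalar, bspline_two_eq_hermite]
    push_cast
    simp [Fin.sum_univ_two, hermitePair, toScalar]
    ring

theorem reproduces_bspline_three : Reproduces (hermitePair 𝕜) (toScalar 𝕜 (bspline 3)) := by
  refine Reproduces.of_eq_sum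
    ![fun k => if k = 1 then 1 / 6 else if k = 2 then 2 / 3 else if k = 3 then 1 / 6 else 0,
      fun k => if k = 1 then 1 / 2 else if k = 3 then -1 / 2 else 0] {1, 2, 3} ?_ ?_
  · intro i k hk
    simp only [Finset.mem_insert, Finset.mem_singleton, not_or] at hk
    fin_cases i <;> simp [hk]
  · intro t
    simp only [toScalar, bspline_three_eq_hermite]
    push_cast
    simp [Fin.sum_univ_two, hermitePair, toScalar]
    ring

end Reproduction

/-! ### Riesz bounds from the local Gram form -/

section Riesz

variable {𝕜 : Type*} [RCLike 𝕜]

/-- The cubic on `[0, 1]` with values `a₀, a₁` and derivatives `b₀, b₁` at the end points. -/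
noncomputable def hermiteCubic (a₀ b₀ a₁ b₁ x : ℝ) : ℝ :=
  a₀ * ((2 * x + 1) * (x - 1) ^ 2) + b₀ * (x * (x - 1) ^ 2) + a₁ * ((3 - 2 * x) * x ^ 2)
    + b₁ * ((x - 1) * x ^ 2)

theorem continuous_hermiteCubic (a₀ b₀ a₁ b₁ : ℝ) : Continuous (hermiteCubic a₀ b₀ a₁ b₁) := by
  unfold hermiteCubic
  fun_prop

theorem integral_sum_mul_pow {d : ℕ} (e : Fin d → ℝ) :
    ∫ x in (0 : ℝ)..1, ∑ j, e j * x ^ (j : ℕ) = ∑ j, e j / ((j : ℕ) + 1) := by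
  rw [intervalIntegral.integral_finsetSum fun j _ =>
    (Continuous.intervalIntegrable (by fun_prop) _ _)]
  refine Finset.sum_congr rfl fun j _ => ?_
  rw [intervalIntegral.integral_const_mul, integral_pow]
  simp [div_eq_mul_inv]

theorem integral_hermiteCubic_sq (a₀ b₀ a₁ b₁ : ℝ) :
    ∫ x in (0 : ℝ)..1, hermiteCubic a₀ b₀ a₁ b₁ x ^ 2 =
      (156 * (a₀ ^ 2 + a₁ ^ 2) + 4 * (b₀ ^ 2 + b₁ ^ 2) + 44 * (a₀ * b₀ - a₁ * b₁)
        + 108 * (a₀ * a₁) + 26 * (b₀ * a₁ - a₀ * b₁) - 6 * (b₀ * b₁)) / 420 := by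
  obtain ⟨γ, hγ⟩ : ∃ γ, γ = -3 * a₀ - 2 * b₀ + 3 * a₁ - b₁ := ⟨_, rfl⟩
  obtain ⟨δ, hδ⟩ : ∃ δ, δ = 2 * a₀ + b₀ - 2 * a₁ + b₁ := ⟨_, rfl⟩
  have h := integral_sum_mul_pow ![a₀ ^ 2, 2 * a₀ * b₀, 2 * a₀ * γ + b₀ ^ 2,
    2 * a₀ * δ + 2 * b₀ * γ, 2 * b₀ * δ + γ ^ 2, 2 * γ * δ, δ ^ 2]
  have h' : ∀ x, hermiteCubic a₀ b₀ a₁ b₁ x ^ 2 = ∑ j : Fin 7, (![a₀ ^ 2, 2 * a₀ * b₀,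
      2 * a₀ * γ + b₀ ^ 2, 2 * a₀ * δ + 2 * b₀ * γ, 2 * b₀ * δ + γ ^ 2, 2 * γ * δ, δ ^ 2] :
      Fin 7 → ℝ) j * x ^ (j : ℕ) := by
    intro x
    simp [Fin.sum_univ_succ, hermiteCubic, hγ, hδ]
    ring
  simp only [h', h]
  simp [Fin.sum_univ_succ, hγ, hδ]
  ring

theorem integral_hermiteCubic_sq_le (a₀ b₀ a₁ b₁ : ℝ) :
    ∫ x in (0 : ℝ)..1, hermiteCubic a₀ b₀ a₁ b₁ x ^ 2 ≤ a₀ ^ 2 + b₀ ^ 2 + a₁ ^ 2 + b₁ ^ 2 := by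
  rw [integral_hermiteCubic_sq]
  nlinarith [sq_nonneg (a₀ - b₀), sq_nonneg (a₁ + b₁), sq_nonneg (a₀ - a₁), sq_nonneg (b₀ - a₁),
    sq_nonneg (a₀ + b₁), sq_nonneg (b₀ + b₁), sq_nonneg a₀, sq_nonneg a₁, sq_nonneg b₀,
    sq_nonneg b₁]

/-- The form splits into two positive definite binary forms, one in `(a₀ + a₁, b₀ - b₁)` and one in
`(a₀ - a₁, b₀ + b₁)`. -/
theorem le_integral_hermiteCubic_sq (a₀ b₀ a₁ b₁ : ℝ) :
    1 / 4200 * (a₀ ^ 2 + b₀ ^ 2 + a₁ ^ 2 + b₁ ^ 2) ≤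
      ∫ x in (0 : ℝ)..1, hermiteCubic a₀ b₀ a₁ b₁ x ^ 2 := by
  rw [integral_hermiteCubic_sq]
  nlinarith [sq_nonneg (6 * (a₀ + a₁) + (b₀ - b₁)), sq_nonneg (a₀ + a₁), sq_nonneg (b₀ - b₁),
    sq_nonneg (10 * (a₀ - a₁) + 9 / 10 * (b₀ + b₁)), sq_nonneg (a₀ - a₁), sq_nonneg (b₀ + b₁)]

theorem hermitePair_of_one_le_abs (i : Fin 2) {t : ℝ} (h : 1 ≤ |t|) : hermitePair 𝕜 i t = 0 := by
  fin_cases i <;>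
    simp [hermitePair, toScalar, hermite₁_of_one_le_abs h, hermite₂_of_one_le_abs h]

/-- The sum of the Hermite series with coefficients `c`. -/
noncomputable def hermiteSeries (c : Fin 2 → ℤ → 𝕜) (t : ℝ) : 𝕜 :=
  ∑' p : Fin 2 × ℤ, c p.1 p.2 * hermitePair 𝕜 p.1 (t - (p.2 : ℝ))

theorem hermiteSeries_add_intCast (c : Fin 2 → ℤ → 𝕜) (n : ℤ) {x : ℝ} (h0 : 0 ≤ x) (h1 : x ≤ 1) :
    hermiteSeries c (x + n) =
      c 0 n * (((2 * x + 1) * (x - 1) ^ 2 : ℝ) : 𝕜) + c 1 n * ((x * (x - 1) ^ 2 : ℝ) : 𝕜)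
      + c 0 (n + 1) * (((3 - 2 * x) * x ^ 2 : ℝ) : 𝕜)
      + c 1 (n + 1) * (((x - 1) * x ^ 2 : ℝ) : 𝕜) := by
  have e1 : ∀ (y : ℝ) , y + n - ((n + 1 : ℤ) : ℝ) = y - 1 := fun y => by push_cast; ring
  rw [hermiteSeries, tsum_eq_sum (s := Finset.univ ×ˢ {n, n + 1}), Finset.sum_product,
    Fin.sum_univ_two, Finset.sum_pair (by simp), Finset.sum_pair (by simp)]
  · simp only [hermitePair, toScalar, Matrix.cons_val_zero, Matrix.cons_val_one,
      add_sub_cancel_right, e1, hermite₁_of_nonneg h0 h1, hermite₂_of_nonneg h0 h1,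
      hermite₁_of_nonpos (sub_nonpos.2 h1) (by linarith : -1 ≤ x - 1),
      hermite₂_of_nonpos (sub_nonpos.2 h1) (by linarith : -1 ≤ x - 1)]
    push_cast
    ring
  · rintro ⟨i, k⟩ hk
    simp only [Finset.mem_product, Finset.mem_univ, true_and, Finset.mem_insert,
      Finset.mem_singleton, not_or] at hk
    rw [hermitePair_of_one_le_abs, mul_zero]
    rcases lt_or_gt_of_ne hk.1 with h | h
    · have : (k : ℝ) + 1 ≤ n := by exact_mod_cast h
      exact le_abs.2 (Or.inl (by simp only; linarith))
    · have : (n : ℝ) + 1 + 1 ≤ k := by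
        have : n + 1 + 1 ≤ k := by omega
        exact_mod_cast this
      exact le_abs.2 (Or.inr (by simp only; linarith))

theorem measurable_hermiteSeries (c : Fin 2 → ℤ → 𝕜) : Measurable (hermiteSeries c) := by
  have h : hermiteSeries c = fun t =>
      c 0 ⌊t⌋ * (((2 * Int.fract t + 1) * (Int.fract t - 1) ^ 2 : ℝ) : 𝕜)
      + c 1 ⌊t⌋ * ((Int.fract t * (Int.fract t - 1) ^ 2 : ℝ) : 𝕜)
      + c 0 (⌊t⌋ + 1) * (((3 - 2 * Int.fract t) * Int.fract t ^ 2 : ℝ) : 𝕜)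
      + c 1 (⌊t⌋ + 1) * (((Int.fract t - 1) * Int.fract t ^ 2 : ℝ) : 𝕜) := by
    ext t
    rw [← hermiteSeries_add_intCast c _ (Int.fract_nonneg t) (Int.fract_lt_one t).le,
      Int.fract_add_floor]
  rw [h]
  have hc : ∀ d : ℤ → 𝕜, Measurable fun t : ℝ => d ⌊t⌋ := fun d =>
    (measurable_of_countable d).comp Int.measurable_floor
  have hr : ∀ r : ℝ → ℝ, Measurable r → Measurable fun t : ℝ => ((r t : ℝ) : 𝕜) := fun r hr =>
    RCLike.measurable_ofReal.comp hr
  have hx : Measurable (Int.fract : ℝ → ℝ) := measurable_fract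
  exact ((((hc (c 0)).mul (hr _ (by fun_prop))).add ((hc (c 1)).mul (hr _ (by fun_prop)))).add
    ((hc fun k => c 0 (k + 1)).mul (hr _ (by fun_prop)))).add
    ((hc fun k => c 1 (k + 1)).mul (hr _ (by fun_prop)))

theorem norm_hermiteSeries_sq (c : Fin 2 → ℤ → 𝕜) (n : ℤ) {x : ℝ} (h0 : 0 ≤ x) (h1 : x ≤ 1) :
    ‖hermiteSeries c (x + n)‖ ^ 2 =
      hermiteCubic (RCLike.re (c 0 n)) (RCLike.re (c 1 n)) (RCLike.re (c 0 (n + 1)))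
        (RCLike.re (c 1 (n + 1))) x ^ 2 +
      hermiteCubic (RCLike.im (c 0 n)) (RCLike.im (c 1 n)) (RCLike.im (c 0 (n + 1)))
        (RCLike.im (c 1 (n + 1))) x ^ 2 := by
  rw [hermiteSeries_add_intCast c n h0 h1, RCLike.norm_sq_eq_def]
  simp only [map_add, RCLike.mul_re, RCLike.mul_im, RCLike.ofReal_re, RCLike.ofReal_im, mul_zero,
    sub_zero, zero_add, hermiteCubic]
  ring

theorem enorm_sq_eq_ofReal (z : 𝕜) : ‖z‖ₑ ^ 2 = ENNReal.ofReal (‖z‖ ^ 2) := by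
  rw [← ofReal_norm, ENNReal.ofReal_pow (norm_nonneg z)]

theorem setLIntegral_hermiteSeries (c : Fin 2 → ℤ → 𝕜) (n : ℤ) :
    ∫⁻ t in Set.Ico (n : ℝ) (n + 1), ‖hermiteSeries c t‖ₑ ^ 2 =
      ENNReal.ofReal (
        (∫ x in (0 : ℝ)..1, hermiteCubic (RCLike.re (c 0 n)) (RCLike.re (c 1 n))
          (RCLike.re (c 0 (n + 1))) (RCLike.re (c 1 (n + 1))) x ^ 2) +
        ∫ x in (0 : ℝ)..1, hermiteCubic (RCLike.im (c 0 n)) (RCLike.im (c 1 n))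
          (RCLike.im (c 0 (n + 1))) (RCLike.im (c 1 (n + 1))) x ^ 2) := by
  have hmp : MeasurePreserving (fun x : ℝ => x + n) (volume.restrict (Set.Ico (0 : ℝ) 1))
      (volume.restrict (Set.Ico (n : ℝ) (n + 1))) := by
    have := (measurePreserving_add_right volume (n : ℝ)).restrict_preimage
      (measurableSet_Ico (a := (n : ℝ)) (b := n + 1))
    simpa [Set.preimage_add_const_Ico] using this
  have hcont : ∀ a₀ b₀ a₁ b₁ : ℝ, Continuous fun x => hermiteCubic a₀ b₀ a₁ b₁ x ^ 2 :=
    fun a₀ b₀ a₁ b₁ => (continuous_hermiteCubic a₀ b₀ a₁ b₁).pow 2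
  rw [← hmp.lintegral_comp ((measurable_hermiteSeries c).enorm.pow_const 2),
    ← intervalIntegral.integral_add ((hcont _ _ _ _).intervalIntegrable _ _)
      ((hcont _ _ _ _).intervalIntegrable _ _),
    intervalIntegral.integral_of_le zero_le_one, ← integral_Ico_eq_integral_Ioc,
    ofReal_integral_eq_lintegral_ofReal]
  · refine setLIntegral_congr_fun measurableSet_Ico fun x hx => ?_
    simp only [enorm_sq_eq_ofReal, norm_hermiteSeries_sq c n hx.1 hx.2.le]
  · exact (((hcont _ _ _ _).add (hcont _ _ _ _)).integrableOn_Icc).mono_set Set.Ico_subset_Icc_self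
  · exact Eventually.of_forall fun x => by positivity

theorem setLIntegral_hermiteSeries_le (c : Fin 2 → ℤ → 𝕜) (n : ℤ) :
    ∫⁻ t in Set.Ico (n : ℝ) (n + 1), ‖hermiteSeries c t‖ₑ ^ 2 ≤
      ∑ i, (‖c i n‖ₑ ^ 2 + ‖c i (n + 1)‖ₑ ^ 2) := by
  rw [setLIntegral_hermiteSeries]
  simp only [Fin.sum_univ_two, enorm_sq_eq_ofReal]
  rw [← ENNReal.ofReal_add (by positivity) (by positivity),
    ← ENNReal.ofReal_add (by positivity) (by positivity),
    ← ENNReal.ofReal_add (by positivity) (by positivity)]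
  refine ENNReal.ofReal_le_ofReal ?_
  simp only [RCLike.norm_sq_eq_def]
  refine (add_le_add (integral_hermiteCubic_sq_le _ _ _ _)
    (integral_hermiteCubic_sq_le _ _ _ _)).trans_eq ?_
  ring

theorem le_setLIntegral_hermiteSeries (c : Fin 2 → ℤ → 𝕜) (n : ℤ) :
    ENNReal.ofReal (1 / 4200) * ∑ i, (‖c i n‖ₑ ^ 2 + ‖c i (n + 1)‖ₑ ^ 2) ≤
      ∫⁻ t in Set.Ico (n : ℝ) (n + 1), ‖hermiteSeries c t‖ₑ ^ 2 := by
  rw [setLIntegral_hermiteSeries]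
  simp only [Fin.sum_univ_two, enorm_sq_eq_ofReal]
  rw [← ENNReal.ofReal_add (by positivity) (by positivity),
    ← ENNReal.ofReal_add (by positivity) (by positivity),
    ← ENNReal.ofReal_add (by positivity) (by positivity), ← ENNReal.ofReal_mul (by norm_num)]
  refine ENNReal.ofReal_le_ofReal ?_
  simp only [RCLike.norm_sq_eq_def]
  refine le_trans (le_of_eq ?_) (add_le_add (le_integral_hermiteCubic_sq _ _ _ _)
    (le_integral_hermiteCubic_sq _ _ _ _))
  ring

theorem lintegral_eq_tsum_Ico (g : ℝ → ENNReal) :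
    ∫⁻ t, g t = ∑' n : ℤ, ∫⁻ t in Set.Ico (n : ℝ) (n + 1), g t := by
  rw [← lintegral_iUnion (fun _ => measurableSet_Ico) (Set.pairwise_disjoint_Ico_intCast ℝ),
    iUnion_Ico_intCast, setLIntegral_univ]

/-- Each knot is an end point of two unit intervals, hence the factor 2. -/
theorem tsum_sum_add_shift (g : Fin 2 → ℤ → ENNReal) :
    ∑' n, ∑ i, (g i n + g i (n + 1)) = 2 * ∑' p : Fin 2 × ℤ, g p.1 p.2 := by
  rw [ENNReal.summable.tsum_prod' fun _ => ENNReal.summable,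
    tsum_fintype (L := .unconditional (Fin 2)), Finset.mul_sum, Summable.tsum_finsetSum fun _ _ => ENNReal.summable]
  refine Finset.sum_congr rfl fun i _ => ?_
  rw [ENNReal.tsum_add, two_mul]
  congr 1
  exact (Equiv.addRight (1 : ℤ)).tsum_eq (g i)

theorem lintegral_hermiteSeries_le (c : Fin 2 → ℤ → 𝕜) :
    ∫⁻ t, ‖hermiteSeries c t‖ₑ ^ 2 ≤ 2 * ∑' p : Fin 2 × ℤ, ‖c p.1 p.2‖ₑ ^ 2 := by
  rw [lintegral_eq_tsum_Ico, ← tsum_sum_add_shift fun i k => ‖c i k‖ₑ ^ 2]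
  exact ENNReal.tsum_le_tsum fun n => setLIntegral_hermiteSeries_le c n

theorem le_lintegral_hermiteSeries (c : Fin 2 → ℤ → 𝕜) :
    ENNReal.ofReal (1 / 4200) * (2 * ∑' p : Fin 2 × ℤ, ‖c p.1 p.2‖ₑ ^ 2) ≤
      ∫⁻ t, ‖hermiteSeries c t‖ₑ ^ 2 := by
  rw [lintegral_eq_tsum_Ico, ← tsum_sum_add_shift fun i k => ‖c i k‖ₑ ^ 2, ← ENNReal.tsum_mul_left]
  exact ENNReal.tsum_le_tsum fun n => le_setLIntegral_hermiteSeries c n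

theorem eLpNorm_two_eq (f : ℝ → 𝕜) :
    eLpNorm f 2 volume = (∫⁻ t, ‖f t‖ₑ ^ 2) ^ (1 / 2 : ℝ) := by
  simp [eLpNorm_eq_lintegral_rpow_enorm_toReal]

theorem eLpNorm_two_sq (f : ℝ → 𝕜) : eLpNorm f 2 volume ^ 2 = ∫⁻ t, ‖f t‖ₑ ^ 2 := by
  rw [eLpNorm_two_eq, ← ENNReal.rpow_natCast, ← ENNReal.rpow_mul]
  norm_num

theorem summable_hermiteSeries (c : Fin 2 → ℤ → 𝕜) (t : ℝ) :
    Summable fun p : Fin 2 × ℤ => c p.1 p.2 * hermitePair 𝕜 p.1 (t - (p.2 : ℝ)) := by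
  refine summable_of_ne_finset_zero (s := Finset.univ ×ˢ Finset.Icc ⌊t⌋ (⌊t⌋ + 1)) fun p hp => ?_
  rw [hermitePair_of_one_le_abs, mul_zero]
  simp only [Finset.mem_product, Finset.mem_univ, Finset.mem_Icc, true_and, not_and_or,
    not_le] at hp
  rcases hp with h | h
  · have : (p.2 : ℝ) + 1 ≤ ⌊t⌋ := by exact_mod_cast h
    exact le_abs.2 (Or.inl (by linarith [Int.floor_le t]))
  · have : (⌊t⌋ : ℝ) + 1 + 1 ≤ p.2 := by exact_mod_cast h
    exact le_abs.2 (Or.inr (by linarith [Int.lt_floor_add_one t]))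

/-- The remainder is again a Hermite series, so the upper bound applied to it proves `L²`
convergence. -/
theorem hermiteSeries_sub_sum (c : Fin 2 → ℤ → 𝕜) (s : Finset (Fin 2 × ℤ)) (t : ℝ) :
    hermiteSeries c t - ∑ p ∈ s, c p.1 p.2 * hermitePair 𝕜 p.1 (t - (p.2 : ℝ)) =
      hermiteSeries (fun i k => if (i, k) ∈ s then 0 else c i k) t := by
  have h := (summable_hermiteSeries c t).hasSum.sub (hasSum_sum_of_ne_finset_zero (s := s)
    (f := fun p : Fin 2 × ℤ =>
      if p ∈ s then c p.1 p.2 * hermitePair 𝕜 p.1 (t - (p.2 : ℝ)) else 0) (by simp +contextual))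
  rw [Finset.sum_congr rfl fun p hp => if_pos hp] at h
  refine h.tsum_eq.symm.trans (tsum_congr fun p => ?_)
  by_cases hp : p ∈ s <;> simp [hp]

theorem hasShiftExpansion_hermiteSeries {c : Fin 2 → ℤ → 𝕜}
    (hc : ∑' p : Fin 2 × ℤ, ‖c p.1 p.2‖ₑ ^ 2 ≠ ⊤) :
    HasShiftExpansion (hermitePair 𝕜) c (hermiteSeries c) := by
  have htail : Tendsto (fun s : Finset (Fin 2 × ℤ) =>
      (2 * ∑' p : {p // p ∉ s}, ‖c p.1.1 p.1.2‖ₑ ^ 2) ^ (1 / 2 : ℝ)) atTop (𝓝 0) := by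
    have h := ENNReal.Tendsto.const_mul (ENNReal.tendsto_tsum_compl_atTop_zero hc)
      (Or.inr (ENNReal.ofNat_ne_top (n := 2)))
    have h' := (ENNReal.continuous_rpow_const (y := (1 / 2 : ℝ))).tendsto _ |>.comp h
    simpa [Function.comp_def] using h'
  refine tendsto_of_tendsto_of_tendsto_of_le_of_le tendsto_const_nhds htail (fun _ => bot_le) ?_
  intro s
  simp only [hermiteSeries_sub_sum, eLpNorm_two_eq]
  refine ENNReal.rpow_le_rpow ((lintegral_hermiteSeries_le _).trans_eq ?_) (by norm_num)
  congr 1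
  refine Eq.trans (tsum_congr fun p => ?_)
    (tsum_subtype {p | p ∉ s} fun p : Fin 2 × ℤ => ‖c p.1 p.2‖ₑ ^ 2).symm
  by_cases hp : p ∈ s <;> simp [hp]

theorem memLp_hermiteSeries {c : Fin 2 → ℤ → 𝕜} (hc : ∑' p : Fin 2 × ℤ, ‖c p.1 p.2‖ₑ ^ 2 ≠ ⊤) :
    MemLp (hermiteSeries c) 2 volume := by
  refine ⟨(measurable_hermiteSeries c).aestronglyMeasurable, ?_⟩
  rw [eLpNorm_two_eq]
  exact ENNReal.rpow_lt_top_of_nonneg (by norm_num) ((lintegral_hermiteSeries_le c).trans_lt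
    (ENNReal.mul_lt_top (by simp) hc.lt_top)).ne

theorem memLp_hermitePair (i : Fin 2) : MemLp (hermitePair 𝕜 i) 2 volume := by
  -- A unit coefficient sequence makes the generator itself a Hermite series.
  let c : Fin 2 → ℤ → 𝕜 := Pi.single i (Pi.single 0 1)
  have hc0 : ∀ p : Fin 2 × ℤ, p ≠ (i, 0) → c p.1 p.2 = 0 := by
    rintro ⟨j, k⟩ hp
    by_cases hj : j = i
    · subst hj
      have hk : k ≠ 0 := fun hk => hp (by rw [hk])
      simp [c, hk]
    · simp [c, hj]
  have hc : hermitePair 𝕜 i = hermiteSeries c := by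
    ext t
    rw [hermiteSeries, tsum_eq_single (i, 0) fun p hp => by rw [hc0 p hp, zero_mul]]
    simp [c]
  rw [hc]
  refine memLp_hermiteSeries ?_
  rw [tsum_eq_single (i, 0) fun p hp => by rw [hc0 p hp]; simp]
  simp [c]

theorem isRieszFamily_hermitePair : IsRieszFamily (hermitePair 𝕜) := by
  -- Twice the local constants `1/4200` and `1`.
  refine ⟨1 / 2100, 2, by norm_num, by norm_num, fun c hc => ?_⟩
  have hT : ∑' p : Fin 2 × ℤ, ‖c p.1 p.2‖ₑ ^ 2 =
      ENNReal.ofReal (∑ i, ∑' k : ℤ, ‖c i k‖ ^ 2) := by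
    rw [ENNReal.summable.tsum_prod' fun _ => ENNReal.summable, tsum_fintype,
      ENNReal.ofReal_sum_of_nonneg fun i _ => tsum_nonneg fun k => by positivity]
    refine Finset.sum_congr rfl fun i _ => ?_
    rw [ENNReal.ofReal_tsum_of_nonneg (fun k => by positivity) (hc i)]
    exact tsum_congr fun k => enorm_sq_eq_ofReal _
  have hpos : 0 ≤ ∑ i, ∑' k : ℤ, ‖c i k‖ ^ 2 :=
    Finset.sum_nonneg fun i _ => tsum_nonneg fun k => by positivity
  have hfin : ∑' p : Fin 2 × ℤ, ‖c p.1 p.2‖ₑ ^ 2 ≠ ⊤ := hT ▸ ENNReal.ofReal_ne_top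
  have hmem := memLp_hermiteSeries hfin
  refine ⟨hermiteSeries c, hmem, hasShiftExpansion_hermiteSeries hfin, ?_, ?_⟩
  · have h := le_lintegral_hermiteSeries c
    rw [← eLpNorm_two_sq, hT] at h
    have h' := ENNReal.toReal_mono (ENNReal.pow_ne_top hmem.2.ne) h
    rw [ENNReal.toReal_pow, ENNReal.toReal_mul, ENNReal.toReal_mul, ENNReal.toReal_ofReal hpos,
      ENNReal.toReal_ofReal (by norm_num), ENNReal.toReal_ofNat] at h'
    linarith
  · have h := lintegral_hermiteSeries_le c
    rw [← eLpNorm_two_sq, hT] at h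
    have h' := ENNReal.toReal_mono (ENNReal.mul_ne_top (by simp) ENNReal.ofReal_ne_top) h
    rwa [ENNReal.toReal_pow, ENNReal.toReal_mul, ENNReal.toReal_ofReal hpos,
      ENNReal.toReal_ofNat] at h'

end Riesz

/-! ### Minimal total support -/

section Minimality

variable {𝕜 : Type*} [RCLike 𝕜]

theorem four_le_totalSupportMeasure {N : ℕ} {φ : Fin N → ℝ → 𝕜}
    (hφ : ∀ i, MemLp (φ i) 2 volume) (h : Reproduces φ (toScalar 𝕜 (bspline 3))) :
    4 ≤ totalSupportMeasure φ := by
  obtain ⟨c, -, hc⟩ := h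
  have := hc.le_totalSupportMeasure (n := 4) (fun i => (hφ i).1)
    (RCLike.measurable_ofReal.comp (measurable_bspline 3)).aestronglyMeasurable
    bspline_three_shifts_independent
  exact_mod_cast this

theorem totalSupportLength_hermitePair_le : totalSupportLength (hermitePair 𝕜) ≤ 4 := by
  have h : ∀ i, Metric.ediam (essSupport (hermitePair 𝕜 i)) ≤ 2 := by
    intro i
    refine (Metric.ediam_mono (essSupport_subset_of_isClosed (K := Set.Icc (-1) 1) isClosed_Icc
      fun x hx => hermitePair_of_one_le_abs i ?_)).trans ?_
    · rw [Set.mem_Icc, ← abs_le] at hx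
      exact (not_le.1 hx).le
    · rw [Real.ediam_Icc]
      norm_num
  refine (Finset.sum_le_sum fun i _ => h i).trans_eq ?_
  norm_num

end Minimality

theorem corollary1 {𝕜 : Type*} [RCLike 𝕜] :
    -- the Hermite pair is an admissible pair of basis functions
    (∀ i, MemLp (hermitePair 𝕜 i) 2 volume) ∧
    IsRieszFamily (hermitePair 𝕜) ∧
    Reproduces (hermitePair 𝕜) (toScalar 𝕜 (bspline 2)) ∧
    Reproduces (hermitePair 𝕜) (toScalar 𝕜 (bspline 3)) ∧
    -- its total support size is 4
    totalSupportMeasure (hermitePair 𝕜) = 4 ∧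
    totalSupportLength (hermitePair 𝕜) = 4 ∧
    -- and no pair with the same reproduction properties does better
    (∀ φ : Fin 2 → ℝ → 𝕜, (∀ i, MemLp (φ i) 2 volume) →
      Reproduces φ (toScalar 𝕜 (bspline 2)) →
      Reproduces φ (toScalar 𝕜 (bspline 3)) →
      totalSupportMeasure (hermitePair 𝕜) ≤ totalSupportMeasure φ ∧
      totalSupportLength (hermitePair 𝕜) ≤ totalSupportLength φ) := by
  -- The chain `4 ≤ measure ≤ length ≤ 4` pins both sizes.
  have hlow : 4 ≤ totalSupportMeasure (hermitePair 𝕜) :=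
    four_le_totalSupportMeasure memLp_hermitePair reproduces_bspline_three
  have hup := totalSupportLength_hermitePair_le (𝕜 := 𝕜)
  have hle := totalSupportMeasure_le_totalSupportLength (hermitePair 𝕜)
  refine ⟨memLp_hermitePair, isRieszFamily_hermitePair, reproduces_bspline_two,
    reproduces_bspline_three, le_antisymm (hle.trans hup) hlow, le_antisymm hup (hlow.trans hle),
    fun φ hφ _ h3 => ?_⟩
  have h4 := four_le_totalSupportMeasure hφ h3
  exact ⟨(hle.trans hup).trans h4,
    hup.trans (h4.trans (totalSupportMeasure_le_totalSupportLength φ))⟩
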